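/- Let $(\Omega,\mathcal F)$ be a measurable space, let $\mathcal P$ be a collection of probability measures on it, and let $X_1,X_2,\dots$ be real-valued random variables on $(\Omega,\mathcal F)$ that are independent and identically distributed under every $P\in\mathcal P$; write $X$ for a generic $X_i$. Suppose that for some $\delta>0$ $$\sup_{P\in\mathcal P}\mathbb E_P\bigl|X-\mathbb E_P(X)\bigr|^{2+\delta}<\infty\qquad\text{and}\qquad \inf_{P\in\mathcal P}\mathrm{Var}_P(X)>0 .$$ Let $\sigma_P^2:=\mathrm{Var}_P(X)$, $\widehat\mu_n:=\frac1n\sum_{i=1}^nX_i$ and $\widehat\sigma_n^2:=\frac1n\sum_{i=1}^n(X_i-\widehat\mu_n)^2$. Then the sample variance is a $\mathcal P$-uniformly almost-surely consistent estimator of the variance at a polynomial rate: there exists $\beta>0$ such that $\widehat\sigma_n^2-\sigma^2=\bar o_{\mathcal P}(n^{-\beta})$, meaning that for every $\varepsilon>0$ $$\lim_{m\to\infty}\ \sup_{P\in\mathcal P}\ P\Bigl(\sup_{k\ge m}k^{\beta}\bigl|\widehat\sigma_k^2-\sigma_P^2\bigr|\ge\varepsilon\Bigr)=0 .$$ -/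

import Mathlib

open MeasureTheory ProbabilityTheory Filter
open scoped ENNReal Topology

/-- The sample mean `(1/n) ∑_{i=1}^n X_i`; the observations `X_1, X_2, …` are indexed from `0`. -/
noncomputable def sampleMean {Ω : Type*} (X : ℕ → Ω → ℝ) (n : ℕ) (ω : Ω) : ℝ :=
  (∑ i ∈ Finset.range n, X i ω) / n

/-- The sample variance `(1/n) ∑_{i=1}^n (X_i - μ̂_n)²`, where `μ̂_n` is the sample mean. -/
noncomputable def sampleVariance {Ω : Type*} (X : ℕ → Ω → ℝ) (n : ℕ) (ω : Ω) : ℝ :=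
  (∑ i ∈ Finset.range n, (X i ω - sampleMean X n ω) ^ 2) / n

/-- Under the probability measure `P` the random variables `X_1, X_2, …` are independent and
identically distributed. -/
def IsIID {Ω : Type*} [MeasurableSpace Ω] (X : ℕ → Ω → ℝ) (P : Measure Ω) : Prop :=
  iIndepFun X P ∧ ∀ i, IdentDistrib (X i) (X 0) P P

/-- `sup_{P ∈ 𝔓} E_P |Y - E_P Y|^p < ∞`. The expectation of the nonnegative variable
`|Y - E_P Y|^p` is a Lebesgue integral with values in `[0, ∞]`. For `1 ≤ p` this implies that
`Y` is integrable under each `P ∈ 𝔓`, so `E_P Y` is a genuine expectation. -/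
def HasUniformlyBoundedCentralMoment {Ω : Type*} [MeasurableSpace Ω]
    (𝔓 : Set (ProbabilityMeasure Ω)) (Y : Ω → ℝ) (p : ℝ) : Prop :=
  ⨆ P ∈ 𝔓, ∫⁻ ω, ‖Y ω - ∫ ω', Y ω' ∂(P : Measure Ω)‖ₑ ^ p ∂(P : Measure Ω) < ∞

/-- `inf_{P ∈ 𝔓} Var_P(Y) > 0`, with the infimum taken in `[0, ∞]`. -/
def HasUniformlyPositiveVariance {Ω : Type*} [MeasurableSpace Ω]
    (𝔓 : Set (ProbabilityMeasure Ω)) (Y : Ω → ℝ) : Prop :=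
  0 < ⨅ P ∈ 𝔓, evariance Y (P : Measure Ω)

/-- `Y_n = ō_𝔓(r_n)`: the sequence `Y_n / r_n` converges to `0` `𝔓`-uniformly and almost surely,
`∀ ε > 0, lim_{m → ∞} sup_{P ∈ 𝔓} P (sup_{k ≥ m} |Y_k / r_k| ≥ ε) = 0`.
The variables `Y_k` may depend on `P`, as `θ̂_k - θ(P)` does for an estimator `θ̂_k` of a
parameter `θ(P)`. The supremum over `k` is taken in `[0, ∞]`. -/
def IsUniformASLittleO {Ω : Type*} [MeasurableSpace Ω]
    (𝔓 : Set (ProbabilityMeasure Ω)) (Y : ProbabilityMeasure Ω → ℕ → Ω → ℝ) (r : ℕ → ℝ) : Prop :=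
  ∀ ε : ℝ, 0 < ε →
    Tendsto
      (fun m : ℕ => ⨆ P ∈ 𝔓,
        (P : Measure Ω) {ω | ENNReal.ofReal ε ≤ ⨆ k : ℕ, ⨆ _ : m ≤ k, ‖Y P k ω / r k‖ₑ})
      atTop (𝓝 0)

/-! With `Y_i = X_i - E X`, the error of the sample variance is the average of `Y_i ^ 2 - σ²` minus
the square of the average of the `Y_i`, so a uniform strong law with a rate for two centred iid
sequences suffices. Only moments of order `2 + δ` are available, so `Y_i ^ 2 - σ²` may lack a
variance, and `q`-th moments with `1 < q ≤ 2` take its place.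

The von Bahr–Esseen bound makes the `q`-th moment of a partial sum grow at most linearly, Doob's
inequality extends this to running maxima, and a union bound over the blocks `[m 2^j, m 2^(j+1))` is
a geometric series of order `m ^ (-ρ)`. Every constant depends on `P` only through the moment bound,
hence the uniformity. -/

/-! ### Pointwise inequalities for `|x| ^ q`. -/

/-- The signed power `x ↦ sign(x) |x|^(q-1)`, written as `|x|^(q-2) x`, is Hölder continuous of
order `q - 1 ∈ (0, 1]`. -/
theorem abs_signedPow_sub_le {q : ℝ} (hq1 : 1 < q) (hq2 : q ≤ 2) (x y : ℝ) :
    |(|x| ^ (q - 2) * x - |y| ^ (q - 2) * y)| ≤ 2 * |x - y| ^ (q - 1) := by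
  have hs : 0 < q - 1 := by linarith
  have hs1 : q - 1 ≤ 1 := by linarith
  have hg : ∀ z : ℝ, 0 ≤ z → |z| ^ (q - 2) * z = z ^ (q - 1) := by
    intro z hz
    rcases hz.eq_or_lt with rfl | hz
    · simp [Real.zero_rpow hs.ne']
    · rw [abs_of_pos hz, show q - 1 = (q - 2) + 1 by ring, Real.rpow_add_one hz.ne']
  have hmono : ∀ a b : ℝ, 0 ≤ a → a ≤ b →
      |(|a| ^ (q - 2) * a - |b| ^ (q - 2) * b)| ≤ 2 * |a - b| ^ (q - 1) := by
    intro a b ha hab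
    have h1 := Real.rpow_add_le_add_rpow ha (sub_nonneg.2 hab) hs.le hs1
    have h2 := Real.rpow_le_rpow ha hab hs.le
    rw [add_sub_cancel] at h1
    rw [hg a ha, hg b (ha.trans hab), abs_sub_comm, abs_of_nonneg (sub_nonneg.2 h2),
      abs_sub_comm a b, abs_of_nonneg (sub_nonneg.2 hab)]
    have := Real.rpow_nonneg (sub_nonneg.2 hab) (q - 1)
    linarith
  have hnonneg : ∀ a b : ℝ, 0 ≤ a → 0 ≤ b →
      |(|a| ^ (q - 2) * a - |b| ^ (q - 2) * b)| ≤ 2 * |a - b| ^ (q - 1) := by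
    intro a b ha hb
    rcases le_total a b with h | h
    · exact hmono a b ha h
    · rw [abs_sub_comm, abs_sub_comm a b]
      exact hmono b a hb h
  -- Opposite signs are what force the factor 2: each of the two powers is at most `|a + b| ^ (q -
  -- 1)`.
  have hmixed : ∀ a b : ℝ, 0 ≤ a → 0 ≤ b →
      |(|a| ^ (q - 2) * a + |b| ^ (q - 2) * b)| ≤ 2 * |a + b| ^ (q - 1) := by
    intro a b ha hb
    rw [hg a ha, hg b hb, abs_of_nonneg (by positivity), abs_of_nonneg (by positivity)]
    have h1 := Real.rpow_le_rpow ha (le_add_of_nonneg_right hb) hs.le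
    have h2 := Real.rpow_le_rpow hb (le_add_of_nonneg_left ha) hs.le
    linarith
  rcases le_total 0 x with hx | hx <;> rcases le_total 0 y with hy | hy
  · exact hnonneg x y hx hy
  · simpa [sub_eq_add_neg] using hmixed x (-y) hx (by linarith)
  · have := hmixed (-x) y (by linarith) hy
    rw [← abs_neg, ← abs_neg (x - y)]
    simpa [sub_eq_add_neg, add_comm] using this
  · have := hnonneg (-x) (-y) (by linarith) (by linarith)
    rw [← abs_neg, ← abs_neg (x - y)]
    simpa [sub_eq_add_neg, add_comm] using this

/-- First order expansion of `x ↦ |x|^q` for `1 < q ≤ 2`, with a remainder of order `|b|^q`. -/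
theorem abs_add_rpow_le {q : ℝ} (hq1 : 1 < q) (hq2 : q ≤ 2) (a b : ℝ) :
    |a + b| ^ q ≤ |a| ^ q + q * (|a| ^ (q - 2) * a * b) + 2 * q * |b| ^ q := by
  -- Subtract the linear part at `a`; Hölder continuity then bounds the derivative on the segment,
  -- and the mean value inequality bounds the remainder.
  have hder : ∀ x ∈ Set.uIcc a (a + b), HasDerivWithinAt
      (fun x : ℝ => |x| ^ q - q * (|a| ^ (q - 2) * a) * x)
      (q * |x| ^ (q - 2) * x - q * (|a| ^ (q - 2) * a)) (Set.uIcc a (a + b)) x := by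
    intro x _
    have := (hasDerivAt_abs_rpow x hq1).sub
      ((hasDerivAt_id x).const_mul (q * (|a| ^ (q - 2) * a)))
    rw [mul_one] at this
    exact this.hasDerivWithinAt
  have hbound : ∀ x ∈ Set.uIcc a (a + b),
      ‖q * |x| ^ (q - 2) * x - q * (|a| ^ (q - 2) * a)‖ ≤ 2 * q * |b| ^ (q - 1) := by
    intro x hx
    have h1 : |x - a| ≤ |b| := by
      simpa using Set.abs_sub_left_of_mem_uIcc hx
    have h2 := abs_signedPow_sub_le hq1 hq2 x a
    have h3 : |x - a| ^ (q - 1) ≤ |b| ^ (q - 1) :=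
      Real.rpow_le_rpow (abs_nonneg _) h1 (by linarith)
    rw [mul_assoc, ← mul_sub, Real.norm_eq_abs, abs_mul, abs_of_pos (by linarith : 0 < q)]
    nlinarith
  have hmv := (convex_uIcc a (a + b)).norm_image_sub_le_of_norm_hasDerivWithin_le hder hbound
    Set.left_mem_uIcc Set.right_mem_uIcc
  rw [add_sub_cancel_left, Real.norm_eq_abs, Real.norm_eq_abs] at hmv
  have hb : |b| ^ (q - 1) * |b| = |b| ^ q := by
    rcases (abs_nonneg b).eq_or_lt with h | h
    · rw [← h, mul_zero, Real.zero_rpow (by linarith)]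
    · rw [← Real.rpow_add_one h.ne', sub_add_cancel]
  rw [mul_assoc (2 * q), hb] at hmv
  linarith [le_abs_self (|a + b| ^ q - q * (|a| ^ (q - 2) * a) * (a + b) -
    (|a| ^ q - q * (|a| ^ (q - 2) * a) * a))]

theorem MeasureTheory.MemLp.integrable_abs_rpow {Ω : Type*} [MeasurableSpace Ω] {P : Measure Ω}
    [IsFiniteMeasure P] {f : Ω → ℝ} {q : ℝ} (hq : 0 < q) (hf : MemLp f (ENNReal.ofReal q) P) :
    Integrable (fun ω => |f ω| ^ q) P := by
  simpa [ENNReal.toReal_ofReal hq.le] using hf.integrable_norm_rpow'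

/-! ### Moment and maximal inequalities for partial sums. -/

section PartialSums

variable {Ω : Type*} [MeasurableSpace Ω] {P : Measure Ω} {Z : ℕ → Ω → ℝ} {q C : ℝ}

theorem memLp_partialSum (hLp : ∀ i, MemLp (Z i) (ENNReal.ofReal q) P) (n : ℕ) :
    MemLp (fun ω => ∑ i ∈ Finset.range n, Z i ω) (ENNReal.ofReal q) P :=
  memLp_finsetSum _ fun i _ => hLp i

/-- The **von Bahr–Esseen inequality**, with the constant `2q`: for independent centred variables
and `1 < q ≤ 2`, the `q`-th absolute moment of a sum is at most `2q` times the sum of the moments. -/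
theorem ProbabilityTheory.iIndepFun.integral_abs_sum_rpow_le (hind : iIndepFun Z P)
    (hmeas : ∀ i, Measurable (Z i)) (hq1 : 1 < q) (hq2 : q ≤ 2)
    (hLp : ∀ i, MemLp (Z i) (ENNReal.ofReal q) P) (hmean : ∀ i, ∫ ω, Z i ω ∂P = 0)
    (hC : ∀ i, ∫ ω, |Z i ω| ^ q ∂P ≤ C) (n : ℕ) :
    ∫ ω, |∑ i ∈ Finset.range n, Z i ω| ^ q ∂P ≤ 2 * q * C * n := by
  have : IsProbabilityMeasure P := hind.isProbabilityMeasure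
  have hq0 : 0 < q := by linarith
  induction n with
  | zero => simp [Real.zero_rpow hq0.ne']
  | succ n ih =>
    set S : Ω → ℝ := fun ω => ∑ i ∈ Finset.range n, Z i ω with hS
    have hSm : Measurable S := Finset.measurable_sum _ fun i _ => hmeas i
    have hindS : IndepFun S (Z n) P := by
      have := hind.indepFun_finsetSum_of_notMem hmeas (Finset.notMem_range_self (n := n))
      convert this using 1
      ext ω
      simp [hS]
    have hg : Measurable fun x : ℝ => |x| ^ (q - 2) * x := by fun_prop
    have hindg : IndepFun (fun ω => |S ω| ^ (q - 2) * S ω) (Z n) P :=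
      hindS.comp hg measurable_id
    have hSint : Integrable (fun ω => |S ω| ^ q) P := (memLp_partialSum hLp n).integrable_abs_rpow hq0
    have hZint : Integrable (Z n) P := (hLp n).integrable (by simpa using hq1.le)
    have hgint : Integrable (fun ω => |S ω| ^ (q - 2) * S ω) P := by
      refine ((integrable_const (2 : ℝ)).add (hSint.const_mul 2)).mono'
        (hg.comp hSm).aestronglyMeasurable (ae_of_all _ fun ω => ?_)
      have h1 := abs_signedPow_sub_le hq1 hq2 (S ω) 0
      simp only [mul_zero, sub_zero] at h1
      have h2 : |S ω| ^ (q - 1) ≤ 1 + |S ω| ^ q := by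
        rcases le_total |S ω| 1 with h | h
        · have := Real.rpow_le_one (abs_nonneg _) h (by linarith : 0 ≤ q - 1)
          have := Real.rpow_nonneg (abs_nonneg (S ω)) q
          linarith
        · have := Real.rpow_le_rpow_of_exponent_le h (by linarith : q - 1 ≤ q)
          linarith
      simp only [Pi.add_apply, Real.norm_eq_abs]
      linarith
    have hcint : Integrable (fun ω => |S ω| ^ (q - 2) * S ω * Z n ω) P :=
      hindg.integrable_mul hgint hZint
    -- The first-order term vanishes because `Z n` is centred and independent of `S`.
    have hcross : ∫ ω, |S ω| ^ (q - 2) * S ω * Z n ω ∂P = 0 := by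
      rw [hindg.integral_fun_mul_eq_mul_integral hgint.1 hZint.1, hmean n, mul_zero]
    have hZq := (hLp n).integrable_abs_rpow hq0
    calc ∫ ω, |∑ i ∈ Finset.range (n + 1), Z i ω| ^ q ∂P
        ≤ ∫ ω, (|S ω| ^ q + q * (|S ω| ^ (q - 2) * S ω * Z n ω) + 2 * q * |Z n ω| ^ q) ∂P := by
          refine integral_mono ((memLp_partialSum hLp (n + 1)).integrable_abs_rpow hq0)
            ((hSint.add (hcint.const_mul q)).add (hZq.const_mul (2 * q))) fun ω => ?_
          simp only [Finset.sum_range_succ]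
          exact abs_add_rpow_le hq1 hq2 _ _
      _ = ∫ ω, |S ω| ^ q ∂P + 2 * q * ∫ ω, |Z n ω| ^ q ∂P := by
          rw [integral_add (f := fun ω => |S ω| ^ q + q * (|S ω| ^ (q - 2) * S ω * Z n ω))
              (hSint.add (hcint.const_mul q)) (hZq.const_mul (2 * q)),
            integral_add hSint (hcint.const_mul q), integral_const_mul, integral_const_mul, hcross,
            mul_zero, add_zero]
      _ ≤ 2 * q * C * n + 2 * q * C := by
          gcongr
          exact hC n
      _ = 2 * q * C * (n + 1 : ℕ) := by push_cast; ring

/-- The partial sums `Z_0 + ⋯ + Z_n` of independent centred variables form a martingale with respect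
to the natural filtration. -/
theorem ProbabilityTheory.iIndepFun.martingale_sum_range_succ (hind : iIndepFun Z P)
    (hmeas : ∀ i, StronglyMeasurable (Z i))
    (hint : ∀ i, Integrable (Z i) P) (hmean : ∀ i, ∫ ω, Z i ω ∂P = 0) :
    Martingale (fun n ω => ∑ i ∈ Finset.range (n + 1), Z i ω) (Filtration.natural Z hmeas) P := by
  have : IsProbabilityMeasure P := hind.isProbabilityMeasure
  have hadp : StronglyAdapted (Filtration.natural Z hmeas)
      (fun n ω => ∑ i ∈ Finset.range (n + 1), Z i ω) := by
    intro n
    refine Finset.stronglyMeasurable_fun_sum _ fun i hi => ?_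
    exact (Filtration.stronglyAdapted_natural hmeas i).mono
      ((Filtration.natural Z hmeas).mono (by simpa [Nat.lt_succ_iff] using hi))
  have hsint : ∀ n, Integrable (fun ω => ∑ i ∈ Finset.range (n + 1), Z i ω) P := fun n =>
    integrable_finsetSum _ fun i _ => hint i
  refine martingale_nat hadp hsint fun n => ?_
  have hsum : (fun ω => ∑ i ∈ Finset.range (n + 1 + 1), Z i ω) =
      (fun ω => ∑ i ∈ Finset.range (n + 1), Z i ω) + Z (n + 1) := by
    ext ω
    simp [Finset.sum_range_succ _ (n + 1)]
  rw [hsum]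
  filter_upwards [condExp_add (hsint n) (hint (n + 1)) (Filtration.natural Z hmeas n),
    hind.condExp_natural_ae_eq_of_lt hmeas n.lt_succ_self] with ω h1 h2
  rw [h1, Pi.add_apply, h2, hmean, add_zero,
    condExp_of_stronglyMeasurable (Filtration.le _ n) (hadp n) (hsint n)]

theorem convexOn_abs_rpow (hq : 1 ≤ q) : ConvexOn ℝ Set.univ fun x : ℝ => |x| ^ q := by
  refine ⟨convex_univ, fun x _ y _ a b ha hb hab => ?_⟩
  have h := (convexOn_rpow hq).2 (abs_nonneg x) (abs_nonneg y) ha hb hab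
  refine le_trans (Real.rpow_le_rpow (abs_nonneg _) ?_ (by linarith)) h
  refine (abs_add_le _ _).trans_eq ?_
  simp [abs_mul, abs_of_nonneg ha, abs_of_nonneg hb]

/-- Conditional Jensen for the convex function `|x| ^ q`. -/
theorem MeasureTheory.Martingale.submartingale_abs_rpow [IsFiniteMeasure P]
    {ℱ : Filtration ℕ ‹MeasurableSpace Ω›}
    {M : ℕ → Ω → ℝ} (hM : Martingale M ℱ P) (hq : 1 ≤ q)
    (hLp : ∀ i, MemLp (M i) (ENNReal.ofReal q) P) :
    Submartingale (fun n ω => |M n ω| ^ q) ℱ P := by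
  have hq0 : 0 < q := by linarith
  have hcont : Continuous fun x : ℝ => |x| ^ q :=
    continuous_abs.rpow_const fun _ => Or.inr hq0.le
  refine submartingale_nat (fun n => hcont.comp_stronglyMeasurable (hM.stronglyAdapted n))
    (fun n => (hLp n).integrable_abs_rpow hq0) fun n => ?_
  filter_upwards [(convexOn_abs_rpow hq).map_condExp_le_univ (ℱ.le n) hcont.lowerSemicontinuous
    (hM.integrable (n + 1)) ((hLp (n + 1)).integrable_abs_rpow hq0),
    hM.condExp_ae_eq n.le_succ] with ω h1 h2
  rw [Function.comp_apply, h2] at h1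
  exact h1

/-- A Kolmogorov-type maximal inequality with `q`-th moments, `1 < q ≤ 2`. -/
theorem ProbabilityTheory.iIndepFun.measure_exists_le_abs_sum_le (hind : iIndepFun Z P)
    (hmeas : ∀ i, Measurable (Z i)) (hq1 : 1 < q) (hq2 : q ≤ 2)
    (hLp : ∀ i, MemLp (Z i) (ENNReal.ofReal q) P) (hmean : ∀ i, ∫ ω, Z i ω ∂P = 0)
    (hC : ∀ i, ∫ ω, |Z i ω| ^ q ∂P ≤ C) {t : ℝ} (ht : 0 < t) (n : ℕ) :
    P {ω | ∃ k ≤ n, t ≤ |∑ i ∈ Finset.range k, Z i ω|} ≤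
      ENNReal.ofReal (2 * q * C * n / t ^ q) := by
  have : IsProbabilityMeasure P := hind.isProbabilityMeasure
  have hq0 : 0 < q := by linarith
  -- The martingale at time `n` has `n + 1` summands; the empty sum is treated apart and never
  -- reaches `t > 0`.
  rcases n with _ | n
  · simp [ht.not_ge]
  have hsub := (hind.martingale_sum_range_succ (fun i => (hmeas i).stronglyMeasurable)
    (fun i => (hLp i).integrable (by simpa using hq1.le)) hmean).submartingale_abs_rpow hq1.le
    fun i => memLp_partialSum hLp (i + 1)
  have htq : 0 < t ^ q := Real.rpow_pos_of_pos ht q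
  have hmax := maximal_ineq hsub (fun n ω => Real.rpow_nonneg (abs_nonneg _) q)
    (ε := ⟨t ^ q, htq.le⟩) n
  rw [ENNReal.ofReal_div_of_pos htq, ENNReal.le_div_iff_mul_le
    (Or.inl (by simpa using htq)) (Or.inl ENNReal.ofReal_ne_top), mul_comm]
  refine le_trans (le_trans ?_ hmax) (ENNReal.ofReal_le_ofReal ?_)
  · have : ENNReal.ofReal (t ^ q) = ENNReal.ofNNReal ⟨t ^ q, htq.le⟩ :=
      ENNReal.ofReal_eq_coe_nnreal htq.le
    rw [this]
    gcongr with ω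
    rintro ⟨k, hk, hkt⟩
    rcases k with _ | k
    · simp at hkt; linarith
    refine le_trans (Real.rpow_le_rpow ht.le hkt hq0.le) ?_
    exact Finset.le_sup' (fun k => |∑ i ∈ Finset.range (k + 1), Z i ω| ^ q)
      (Finset.mem_range.2 (by omega))
  · refine le_trans (setIntegral_le_integral
      ((memLp_partialSum hLp (n + 1)).integrable_abs_rpow hq0)
      (ae_of_all _ fun ω => Real.rpow_nonneg (abs_nonneg _) q)) ?_
    exact hind.integral_abs_sum_rpow_le hmeas hq1 hq2 hLp hmean hC (n + 1)

end PartialSums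

/-! ### Dyadic blocks and the quantitative strong law. -/

theorem exists_mul_two_pow_le_lt {m k : ℕ} (hm : 0 < m) (hk : m ≤ k) :
    ∃ j, m * 2 ^ j ≤ k ∧ k < m * 2 ^ (j + 1) := by
  refine ⟨Nat.log 2 (k / m), ?_, ?_⟩
  · have h := Nat.pow_log_le_self 2 (Nat.div_pos hk hm).ne'
    rw [mul_comm]
    exact (Nat.le_div_iff_mul_le hm).1 h
  · have h := Nat.lt_pow_succ_log_self (b := 2) (by norm_num) (k / m)
    rw [mul_comm]
    exact (Nat.div_lt_iff_lt_mul hm).1 h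

/-- A quantitative Marcinkiewicz–Zygmund strong law: the probability that the averages of
independent centred variables ever exceed `t k^(-β)` after time `m` decays polynomially in `m`, with
constants that depend only on a bound on the `q`-th moments. -/
theorem ProbabilityTheory.iIndepFun.measure_exists_le_rpow_mul_abs_average_le
    {Ω : Type*} [MeasurableSpace Ω] {P : Measure Ω} {Z : ℕ → Ω → ℝ} {q C : ℝ}
    (hind : iIndepFun Z P) (hmeas : ∀ i, Measurable (Z i)) (hq1 : 1 < q) (hq2 : q ≤ 2)
    (hLp : ∀ i, MemLp (Z i) (ENNReal.ofReal q) P) (hmean : ∀ i, ∫ ω, Z i ω ∂P = 0)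
    (hC : ∀ i, ∫ ω, |Z i ω| ^ q ∂P ≤ C) {β ρ t : ℝ} (hρ : 0 < ρ) (hβρ : ρ = q - 1 - β * q)
    (ht : 0 < t) {m : ℕ} (hm : 0 < m) :
    P {ω | ∃ k, m ≤ k ∧ t ≤ (k : ℝ) ^ β * |(∑ i ∈ Finset.range k, Z i ω) / k|} ≤
      ENNReal.ofReal (4 * q * C / t ^ q * (1 - 2 ^ (-ρ))⁻¹ * (m : ℝ) ^ (-ρ)) := by
  have hq0 : 0 < q := by linarith
  -- If `β > 1`, then `ρ = q - 1 - β q < -1`.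
  have hβ1 : 0 ≤ 1 - β := by
    by_contra! h
    nlinarith
  have hC0 : 0 ≤ C :=
    (integral_nonneg fun ω => Real.rpow_nonneg (abs_nonneg (Z 0 ω)) q).trans (hC 0)
  have hm0 : (0 : ℝ) < m := by exact_mod_cast hm
  have hsubset : {ω | ∃ k, m ≤ k ∧ t ≤ (k : ℝ) ^ β * |(∑ i ∈ Finset.range k, Z i ω) / k|} ⊆
      ⋃ j : ℕ, {ω | ∃ k ≤ m * 2 ^ (j + 1),
        t * ((m : ℝ) * 2 ^ j) ^ (1 - β) ≤ |∑ i ∈ Finset.range k, Z i ω|} := by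
    rintro ω ⟨k, hk, hkt⟩
    obtain ⟨j, hj1, hj2⟩ := exists_mul_two_pow_le_lt hm hk
    refine Set.mem_iUnion.2 ⟨j, k, hj2.le, ?_⟩
    have hk0 : (0 : ℝ) < k := by exact_mod_cast hm.trans_le hk
    have hj1' : (m : ℝ) * 2 ^ j ≤ k := by exact_mod_cast hj1
    calc t * ((m : ℝ) * 2 ^ j) ^ (1 - β) ≤ t * (k : ℝ) ^ (1 - β) := by gcongr
      _ ≤ ((k : ℝ) ^ β * |(∑ i ∈ Finset.range k, Z i ω) / k|) * (k : ℝ) ^ (1 - β) := by gcongr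
      _ = |∑ i ∈ Finset.range k, Z i ω| := by
        rw [abs_div, abs_of_pos hk0, Real.rpow_sub hk0, Real.rpow_one]
        field_simp
  have hr0 : (0 : ℝ) ≤ 2 ^ (-ρ) := by positivity
  have hr1 : (2 : ℝ) ^ (-ρ) < 1 := Real.rpow_lt_one_of_one_lt_of_neg (by norm_num) (by linarith)
  -- With `N = m 2^j`, the power left is `N ^ (1 - (1 - β) q) = N ^ (-ρ)`; 2 becomes 4 because the
  -- block ends at `2N`.
  have hblock : ∀ j : ℕ, 2 * q * C * (m * 2 ^ (j + 1) : ℕ) / (t * ((m : ℝ) * 2 ^ j) ^ (1 - β)) ^ q =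
      4 * q * C / t ^ q * (m : ℝ) ^ (-ρ) * (2 ^ (-ρ)) ^ j := by
    intro j
    have hN : (0 : ℝ) < m * 2 ^ j := by positivity
    have h1 : ((m : ℝ) * 2 ^ j) / (((m : ℝ) * 2 ^ j) ^ (1 - β)) ^ q =
        (m : ℝ) ^ (-ρ) * (2 ^ (-ρ)) ^ j := by
      rw [← Real.rpow_mul hN.le]
      conv_lhs => rw [← Real.rpow_one ((m : ℝ) * 2 ^ j), ← Real.rpow_mul hN.le,
        ← Real.rpow_sub hN]
      rw [show 1 - 1 * ((1 - β) * q) = -ρ by rw [hβρ]; ring,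
        Real.mul_rpow hm0.le (by positivity), ← Real.rpow_natCast, ← Real.rpow_natCast,
        ← Real.rpow_mul (by norm_num), ← Real.rpow_mul (by norm_num), mul_comm (j : ℝ)]
    rw [mul_assoc (4 * q * C / t ^ q), ← h1, Real.mul_rpow ht.le (by positivity)]
    push_cast
    ring
  calc _ ≤ ∑' j : ℕ, P {ω | ∃ k ≤ m * 2 ^ (j + 1),
        t * ((m : ℝ) * 2 ^ j) ^ (1 - β) ≤ |∑ i ∈ Finset.range k, Z i ω|} :=
        (measure_mono hsubset).trans (measure_iUnion_le _)
    _ ≤ ∑' j : ℕ, ENNReal.ofReal (4 * q * C / t ^ q * (m : ℝ) ^ (-ρ) * (2 ^ (-ρ)) ^ j) := by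
        refine ENNReal.tsum_le_tsum fun j => ?_
        rw [← hblock]
        exact hind.measure_exists_le_abs_sum_le hmeas hq1 hq2 hLp hmean hC (by positivity) _
    _ = _ := by
        rw [← ENNReal.ofReal_tsum_of_nonneg (fun j => by positivity)
          ((summable_geometric_of_lt_one hr0 hr1).mul_left _), tsum_mul_left,
          tsum_geometric_of_lt_one hr0 hr1]
        congr 1
        ring

/-! ### Moments of the centred variable and of its square. -/

section Moments

variable {Ω : Type*} [MeasurableSpace Ω] {P : Measure Ω} {Y : Ω → ℝ} {p q K : ℝ}

theorem memLp_and_integral_abs_rpow_le_of_bound {f g : Ω → ℝ} (hq : 0 < q) (hf : Measurable f)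
    (hg : Integrable g P) (hfg : ∀ ω, |f ω| ^ q ≤ g ω) :
    MemLp f (ENNReal.ofReal q) P ∧ ∫ ω, |f ω| ^ q ∂P ≤ ∫ ω, g ω ∂P := by
  have hint : Integrable (fun ω => |f ω| ^ q) P :=
    hg.mono' (hf.abs.pow_const q).aestronglyMeasurable (ae_of_all _ fun ω => by
      rw [Real.norm_of_nonneg (Real.rpow_nonneg (abs_nonneg _) q)]
      exact hfg ω)
  refine ⟨?_, integral_mono hint hg hfg⟩
  rw [← integrable_norm_rpow_iff hf.aestronglyMeasurable (by simpa using hq) ENNReal.ofReal_ne_top,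
    ENNReal.toReal_ofReal hq.le]
  exact hint

theorem integrable_abs_rpow_and_integral_le_of_lintegral_le (hp : 0 ≤ p) (hY : Measurable Y)
    (hK0 : 0 ≤ K) (hK : ∫⁻ ω, ‖Y ω‖ₑ ^ p ∂P ≤ ENNReal.ofReal K) :
    Integrable (fun ω => |Y ω| ^ p) P ∧ ∫ ω, |Y ω| ^ p ∂P ≤ K := by
  have hmeas : Measurable fun ω => |Y ω| ^ p := by fun_prop
  have henorm : ∀ ω, ENNReal.ofReal (|Y ω| ^ p) = ‖Y ω‖ₑ ^ p := fun ω => by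
    rw [← ENNReal.ofReal_rpow_of_nonneg (abs_nonneg _) hp, Real.enorm_eq_ofReal_abs]
  have hnonneg : 0 ≤ᵐ[P] fun ω => |Y ω| ^ p :=
    ae_of_all _ fun ω => Real.rpow_nonneg (abs_nonneg _) p
  constructor
  · refine ⟨hmeas.aestronglyMeasurable, ?_⟩
    rw [hasFiniteIntegral_iff_ofReal hnonneg]
    simp_rw [henorm]
    exact hK.trans_lt ENNReal.ofReal_lt_top
  · rw [integral_eq_lintegral_of_nonneg_ae hnonneg hmeas.aestronglyMeasurable]
    simp_rw [henorm]
    exact ENNReal.toReal_le_of_le_ofReal hK0 hK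

theorem rpow_le_one_add_rpow {x : ℝ} (hx : 0 ≤ x) (hq : 0 ≤ q) (hqp : q ≤ p) :
    x ^ q ≤ 1 + x ^ p := by
  rcases le_total x 1 with h | h
  · have := Real.rpow_le_one hx h hq
    have := Real.rpow_nonneg hx p
    linarith
  · have := Real.rpow_le_rpow_of_exponent_le h hqp
    linarith

variable [IsProbabilityMeasure P]

theorem memLp_and_integral_abs_rpow_le (hY : Measurable Y) (hq1 : 1 < q) (hqp : 2 * q ≤ p)
    (hint : Integrable (fun ω => |Y ω| ^ p) P) (hK : ∫ ω, |Y ω| ^ p ∂P ≤ K) :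
    MemLp Y (ENNReal.ofReal q) P ∧ ∫ ω, |Y ω| ^ q ∂P ≤ 1 + K := by
  have h := memLp_and_integral_abs_rpow_le_of_bound (P := P) (q := q) (by linarith) hY
    ((integrable_const (1 : ℝ)).add hint)
    fun ω => rpow_le_one_add_rpow (abs_nonneg (Y ω)) (by linarith) (by linarith : q ≤ p)
  refine ⟨h.1, h.2.trans ?_⟩
  simp only [Pi.add_apply]
  rw [integral_add (integrable_const _) hint]
  simpa using hK

/-- For nonnegative `u` and `v`, `|u - v| ≤ max u v`, so `|Y² - v| ^ q ≤ (Y²) ^ q + v ^ q`; the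
first term needs moments of order `2q ≤ p`. -/
theorem memLp_and_integral_abs_sq_sub_rpow_le (hY : Measurable Y) (hq1 : 1 < q) (hq2 : q ≤ 2)
    (hqp : 2 * q ≤ p) (hint : Integrable (fun ω => |Y ω| ^ p) P) (hK : ∫ ω, |Y ω| ^ p ∂P ≤ K) :
    Integrable (fun ω => Y ω ^ 2) P ∧
    MemLp (fun ω => Y ω ^ 2 - ∫ ω, Y ω ^ 2 ∂P) (ENNReal.ofReal q) P ∧
      ∫ ω, |Y ω ^ 2 - ∫ ω, Y ω ^ 2 ∂P| ^ q ∂P ≤ 1 + K + (1 + K) ^ 2 := by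
  have hsq : ∀ ω, Y ω ^ 2 ≤ 1 + |Y ω| ^ p := fun ω => by
    have := rpow_le_one_add_rpow (abs_nonneg (Y ω)) zero_le_two (by linarith : 2 ≤ p)
    rwa [Real.rpow_two, sq_abs] at this
  have h1int : Integrable (fun ω => 1 + |Y ω| ^ p) P := (integrable_const (1 : ℝ)).add hint
  have h1le : ∫ ω, (1 + |Y ω| ^ p) ∂P ≤ 1 + K := by
    rw [integral_add (integrable_const _) hint]
    simpa using hK
  have hsqint : Integrable (fun ω => Y ω ^ 2) P :=
    h1int.mono' (by fun_prop) (ae_of_all _ fun ω => by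
      rw [Real.norm_of_nonneg (sq_nonneg _)]
      exact hsq ω)
  have hv : ∫ ω, Y ω ^ 2 ∂P ≤ 1 + K := (integral_mono hsqint h1int hsq).trans h1le
  have hv0 : 0 ≤ ∫ ω, Y ω ^ 2 ∂P := integral_nonneg fun ω => sq_nonneg _
  refine ⟨hsqint, ?_⟩
  generalize ∫ ω, Y ω ^ 2 ∂P = v at hv hv0 ⊢
  have hK0 : 0 ≤ K :=
    (integral_nonneg fun ω => Real.rpow_nonneg (abs_nonneg (Y ω)) p).trans hK
  have hvq : v ^ q ≤ (1 + K) ^ 2 := by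
    calc v ^ q ≤ (1 + K) ^ q := Real.rpow_le_rpow hv0 hv (by linarith)
      _ ≤ (1 + K) ^ (2 : ℝ) := Real.rpow_le_rpow_of_exponent_le (by linarith) hq2
      _ = (1 + K) ^ 2 := Real.rpow_two _
  have hyq : ∀ ω, (Y ω ^ 2) ^ q ≤ 1 + |Y ω| ^ p := fun ω => by
    have := rpow_le_one_add_rpow (abs_nonneg (Y ω)) (by linarith : 0 ≤ 2 * q) hqp
    rwa [Real.rpow_mul (abs_nonneg _), Real.rpow_two, sq_abs] at this
  have h := memLp_and_integral_abs_rpow_le_of_bound (P := P) (q := q)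
    (f := fun ω => Y ω ^ 2 - v) (by linarith) (by fun_prop)
    (h1int.add (integrable_const ((1 + K) ^ 2))) fun ω => by
      have hy0 := sq_nonneg (Y ω)
      have hpos : 0 ≤ (Y ω ^ 2) ^ q := Real.rpow_nonneg hy0 q
      have hvpos : 0 ≤ v ^ q := Real.rpow_nonneg hv0 q
      have hq0 : 0 ≤ q := by linarith
      simp only [Pi.add_apply]
      rcases le_total v (Y ω ^ 2) with hle | hle
      · have := Real.rpow_le_rpow (abs_nonneg (Y ω ^ 2 - v)) (z := q)
          (by rw [abs_of_nonneg (by linarith)]; linarith : |Y ω ^ 2 - v| ≤ Y ω ^ 2) hq0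
        linarith [hyq ω]
      · have := Real.rpow_le_rpow (abs_nonneg (Y ω ^ 2 - v)) (z := q)
          (by rw [abs_of_nonpos (by linarith)]; linarith : |Y ω ^ 2 - v| ≤ v) hq0
        linarith [hyq ω]
  refine ⟨h.1, h.2.trans ?_⟩
  simp only [Pi.add_apply]
  rw [integral_add h1int (integrable_const _)]
  simpa using h1le

end Moments

/-! ### The sample variance and uniformity over `𝔓`. -/

/-- The deviation of the sample variance from `v`, in terms of averages of `X_i - c` and
`(X_i - c)² - v`. -/
theorem sampleVariance_sub_eq {Ω : Type*} (X : ℕ → Ω → ℝ) (c v : ℝ) {n : ℕ} (hn : 0 < n) (ω : Ω) :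
    sampleVariance X n ω - v = (∑ i ∈ Finset.range n, ((X i ω - c) ^ 2 - v)) / n -
      ((∑ i ∈ Finset.range n, (X i ω - c)) / n) ^ 2 := by
  have hn0 : (n : ℝ) ≠ 0 := by exact_mod_cast hn.ne'
  have hmean : (∑ i ∈ Finset.range n, (X i ω - c)) = n * (sampleMean X n ω - c) := by
    rw [sampleMean, Finset.sum_sub_distrib]
    simp
    field_simp
  have hsq : ∑ i ∈ Finset.range n, (X i ω - sampleMean X n ω) ^ 2 =
      ∑ i ∈ Finset.range n, ((X i ω - c) ^ 2 - v) -
        2 * (sampleMean X n ω - c) * ∑ i ∈ Finset.range n, (X i ω - c) +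
        n * ((sampleMean X n ω - c) ^ 2 + v) := by
    rw [Finset.mul_sum, ← Finset.sum_sub_distrib,
      show (n : ℝ) * ((sampleMean X n ω - c) ^ 2 + v) =
        ∑ i ∈ Finset.range n, ((sampleMean X n ω - c) ^ 2 + v) by simp [mul_add], ← Finset.sum_add_distrib]
    exact Finset.sum_congr rfl fun i _ => by ring
  rw [sampleVariance, hsq, hmean]
  field_simp
  ring

/-- A polynomial tail bound for the deviations of the sample variance, with constants that depend
only on a bound for the central moment of order `p ≥ 2q`. -/
theorem IsIID.measure_le_iSup_sampleVariance_sub_le {Ω : Type*} [MeasurableSpace Ω]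
    {P : Measure Ω} [IsProbabilityMeasure P] {X : ℕ → Ω → ℝ} (hX : ∀ i, Measurable (X i))
    (hiid : IsIID X P) {p q K : ℝ} (hq1 : 1 < q) (hq2 : q ≤ 2) (hqp : 2 * q ≤ p) (hK0 : 0 ≤ K)
    (hK : ∫⁻ ω, ‖X 0 ω - ∫ ω', X 0 ω' ∂P‖ₑ ^ p ∂P ≤ ENNReal.ofReal K)
    {β ρ ε t : ℝ} (hβ : 0 ≤ β) (hρ : 0 < ρ) (hβρ : ρ = q - 1 - β * q) (ht : 0 < t) (ht1 : t ≤ 1)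
    (htε : 4 * t ≤ ε) {m : ℕ} (hm : 0 < m) :
    P {ω | ENNReal.ofReal ε ≤ ⨆ k : ℕ, ⨆ _ : m ≤ k,
        ‖(sampleVariance X k ω - variance (X 0) P) / (k : ℝ) ^ (-β)‖ₑ} ≤
      2 * ENNReal.ofReal (4 * q * (1 + K + (1 + K) ^ 2) / t ^ q * (1 - 2 ^ (-ρ))⁻¹ *
        (m : ℝ) ^ (-ρ)) := by
  set c : ℝ := ∫ ω', X 0 ω' ∂P with hc
  set v : ℝ := variance (X 0) P with hv
  have hXc : ∀ i, Measurable fun ω => X i ω - c := fun i => (hX i).sub_const c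
  obtain ⟨hint, hintK⟩ := integrable_abs_rpow_and_integral_le_of_lintegral_le
    (by linarith : 0 ≤ p) (hXc 0) hK0 hK
  obtain ⟨hYLp, hYC⟩ := memLp_and_integral_abs_rpow_le (hXc 0) hq1 hqp hint hintK
  obtain ⟨hsqint, hZLp, hZC⟩ := memLp_and_integral_abs_sq_sub_rpow_le (hXc 0) hq1 hq2 hqp hint hintK
  have hvar : ∫ ω, (X 0 ω - c) ^ 2 ∂P = v := (variance_eq_integral (hX 0).aemeasurable).symm
  rw [hvar] at hZLp hZC
  have hX0int : Integrable (X 0) P := by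
    refine ((hYLp.integrable (by simpa using hq1.le)).add (integrable_const c)).congr
      (ae_of_all _ fun ω => ?_)
    simp
  have hYm : Measurable fun x : ℝ => x - c := by fun_prop
  have hZm : Measurable fun x : ℝ => (x - c) ^ 2 - v := by fun_prop
  have hYid := fun i => (hiid.2 i).comp hYm
  have hZid := fun i => (hiid.2 i).comp hZm
  have hrpow : Measurable fun x : ℝ => |x| ^ q := measurable_abs.pow_const q
  have hYmean : ∫ ω, (X 0 ω - c) ∂P = 0 := by
    rw [integral_sub hX0int (integrable_const _)]
    simp [hc]
  have hZmean : ∫ ω, ((X 0 ω - c) ^ 2 - v) ∂P = 0 := by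
    rw [integral_sub hsqint (integrable_const _), hvar]
    simp
  have hYtail := (hiid.1.comp (fun _ x => x - c)
      fun _ => hYm).measure_exists_le_rpow_mul_abs_average_le
    (fun i => hYm.comp (hX i)) hq1 hq2 (fun i => (hYid i).memLp_iff.2 hYLp)
    (fun i => (hYid i).integral_eq.trans hYmean)
    -- Larger than needed here, so that both tails share one bound.
    (C := 1 + K + (1 + K) ^ 2)
    (fun i => (((hYid i).comp hrpow).integral_eq.trans_le hYC).trans
      (le_add_of_nonneg_right (sq_nonneg _))) hρ hβρ ht hm
  have hZtail := (hiid.1.comp (fun _ x => (x - c) ^ 2 - v)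
      fun _ => hZm).measure_exists_le_rpow_mul_abs_average_le
    (fun i => hZm.comp (hX i)) hq1 hq2 (fun i => (hZid i).memLp_iff.2 hZLp)
    (fun i => (hZid i).integral_eq.trans hZmean)
    (fun i => ((hZid i).comp hrpow).integral_eq.trans_le hZC) hρ hβρ ht hm
  rw [two_mul]
  refine le_trans (measure_mono ?_) ((measure_union_le _ _).trans (add_le_add hYtail hZtail))
  intro ω hω
  by_contra hnot
  simp only [Set.mem_union, Set.mem_ofPred_eq, not_or, not_exists, not_and, not_le,
    Function.comp_apply] at hnot
  obtain ⟨hY, hZ⟩ := hnot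
  refine absurd (Set.mem_ofPred_eq ▸ hω) (not_le.2 ?_)
  -- Strict bounds for each `k` give only a weak bound on the supremum; the gap `2 * t < ε` restores
  -- strictness.
  refine lt_of_le_of_lt (b := ENNReal.ofReal (2 * t)) (iSup₂_le fun k hk => ?_)
    ((ENNReal.ofReal_lt_ofReal_iff (by linarith)).2 (by linarith))
  have hk0 : 0 < k := hm.trans_le hk
  have hkβ : 1 ≤ (k : ℝ) ^ β := Real.one_le_rpow (by exact_mod_cast hk0) hβ
  have hYk := hY k hk
  have hZk := hZ k hk
  rw [Real.enorm_eq_ofReal_abs, Real.rpow_neg (by positivity), div_inv_eq_mul,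
    sampleVariance_sub_eq X c v hk0]
  refine ENNReal.ofReal_le_ofReal ?_
  generalize (∑ i ∈ Finset.range k, (X i ω - c)) / k = y at hYk ⊢
  generalize (∑ i ∈ Finset.range k, ((X i ω - c) ^ 2 - v)) / k = z at hZk ⊢
  generalize (k : ℝ) ^ β = a at hkβ hYk hZk ⊢
  -- One factor `|y|` absorbs the rate `a`; the other is at most 1 since `a ≥ 1` and `t ≤ 1`.
  have hy : a * y ^ 2 ≤ t := by
    have h1 : |y| ≤ a * |y| := le_mul_of_one_le_left (abs_nonneg y) hkβ
    have h2 : |y| ≤ 1 := by linarith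
    calc a * y ^ 2 = (a * |y|) * |y| := by rw [← sq_abs]; ring
      _ ≤ t * 1 := mul_le_mul hYk.le h2 (abs_nonneg y) ht.le
      _ = t := mul_one t
  calc |(z - y ^ 2) * a| = a * |z - y ^ 2| := by
        rw [abs_mul, abs_of_nonneg (by linarith : 0 ≤ a), mul_comm]
    _ ≤ a * (|z| + |y ^ 2|) := by
        gcongr
        exact abs_sub z _
    _ = a * |z| + a * y ^ 2 := by rw [abs_of_nonneg (sq_nonneg y), mul_add]
    _ ≤ 2 * t := by linarith

theorem mainTheorem9 {Ω : Type*} [MeasurableSpace Ω]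
    (𝔓 : Set (ProbabilityMeasure Ω))
    (X : ℕ → Ω → ℝ) (hX : ∀ i, Measurable (X i))
    (hiid : ∀ P ∈ 𝔓, IsIID X (P : Measure Ω))
    (δ : ℝ) (hδ : 0 < δ)
    (hmoment : HasUniformlyBoundedCentralMoment 𝔓 (X 0) (2 + δ))
    (hvar : HasUniformlyPositiveVariance 𝔓 (X 0)) :
    ∃ β : ℝ, 0 < β ∧
      IsUniformASLittleO 𝔓
        (fun P n ω => sampleVariance X n ω - variance (X 0) (P : Measure Ω))
        (fun n => (n : ℝ) ^ (-β)) := by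
  -- The largest `q ≤ 2` with `2q ≤ 2 + δ`. Taking `β = (q - 1) / (2q)` spends half of `q - 1` on
  -- the rate and leaves `ρ = (q - 1) / 2` for the decay.
  set q : ℝ := min (1 + δ / 2) 2 with hq
  have hq1 : 1 < q := lt_min (by linarith) (by norm_num)
  have hq2 : q ≤ 2 := min_le_right _ _
  have hqδ : 2 * q ≤ 2 + δ := by linarith [min_le_left (1 + δ / 2) 2]
  set ρ : ℝ := (q - 1) / 2 with hρ_def
  have hρ : 0 < ρ := by linarith
  have hq0 : 0 < q := by linarith
  have hβ : 0 < (q - 1) / (2 * q) := div_pos (by linarith) (by linarith)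
  refine ⟨(q - 1) / (2 * q), hβ, fun ε hε => ?_⟩
  set K : ℝ≥0∞ := ⨆ P ∈ 𝔓,
    ∫⁻ ω, ‖X 0 ω - ∫ ω', X 0 ω' ∂(P : Measure Ω)‖ₑ ^ (2 + δ) ∂(P : Measure Ω) with hK
  have hKtop : K ≠ ∞ := hmoment.ne
  set t : ℝ := min (ε / 4) 1
  have ht : 0 < t := lt_min (by linarith) one_pos
  have htε : 4 * t ≤ ε := by linarith [min_le_left (ε / 4) 1]
  set A : ℝ := 4 * q * (1 + K.toReal + (1 + K.toReal) ^ 2) / t ^ q * (1 - 2 ^ (-ρ))⁻¹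
  have hlim : Tendsto (fun m : ℕ => 2 * ENNReal.ofReal (A * (m : ℝ) ^ (-ρ))) atTop (𝓝 0) := by
    have h1 : Tendsto (fun m : ℕ => A * (m : ℝ) ^ (-ρ)) atTop (𝓝 (A * 0)) :=
      ((tendsto_rpow_neg_atTop hρ).comp tendsto_natCast_atTop_atTop).const_mul A
    have h2 := ENNReal.Tendsto.const_mul (a := 2) (ENNReal.tendsto_ofReal h1)
      (Or.inr ENNReal.ofNat_ne_top)
    simpa using h2
  refine tendsto_of_tendsto_of_tendsto_of_le_of_le' tendsto_const_nhds hlim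
    (Eventually.of_forall fun _ => zero_le) ?_
  filter_upwards [eventually_gt_atTop 0] with m hm
  refine iSup₂_le fun P hP => ?_
  refine (hiid P hP).measure_le_iSup_sampleVariance_sub_le hX hq1 hq2 hqδ ENNReal.toReal_nonneg
    ?_ hβ.le hρ ?_ ht (min_le_right _ _) htε hm
  · rw [ENNReal.ofReal_toReal hKtop]
    exact le_iSup₂ (f := fun (P : ProbabilityMeasure Ω) (_ : P ∈ 𝔓) =>
      ∫⁻ ω, ‖X 0 ω - ∫ ω', X 0 ω' ∂(P : Measure Ω)‖ₑ ^ (2 + δ) ∂(P : Measure Ω)) P hP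
  · rw [hρ_def]
    field_simp
    ring
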